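/- Let $d\in\mathbb N$ and $p_0\in(1,d)$. Then $$\mathrm{bmo}(\mathbb{R}^d)\cap L^{p_0}(\mathbb{R}^d)\hookrightarrow \mathrm{BMO}(\mathbb{R}^d)\cap \dot B^{-1}_{\infty,1}(\mathbb{R}^d),$$ that is, the natural map from the left-hand space to the right-hand space is well defined, injective and bounded. Explicitly: there is a constant $C$ (depending only on $d$, $p_0$ and the generator $\varphi$ below) such that every $f\in \mathrm{bmo}\cap L^{p_0}$ belongs to $\mathrm{BMO}$, the functional $u_f:\psi\mapsto\int \psi f$ on $\dot{\mathcal S}(\mathbb R^d)$ belongs to $\dot B^{-1}_{\infty,1}$, and $$\|f\|_{\mathrm{BMO}}+\|u_f\|_{\dot B^{-1}_{\infty,1}}\le C\,\big(\|f\|_{\mathrm{bmo}}+\|f\|_{L^{p_0}}\big);$$ moreover, two functions in $\mathrm{bmo}\cap L^{p_0}$ that differ almost everywhere by a constant are equal almost everywhere. Here functions are complex valued, $Q$ denotes cubes with sides parallel to the axes and $f_Q=\frac1{|Q|}\int_Q f$. For locally integrable $f$, $$\|f\|_{\mathrm{BMO}}=\sup_{Q}\frac1{|Q|}\int_Q|f-f_Q|,\qquad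 \|f\|_{\mathrm{bmo}}=\sup_{|Q|<1}\frac1{|Q|}\int_Q|f-f_Q|+\sup_{|Q|\ge1}\frac1{|Q|}\int_Q|f|,$$ and $\mathrm{BMO}$, $\mathrm{bmo}$ are the spaces where these are finite ($\mathrm{BMO}$ being understood modulo constants). $\dot{\mathcal S}(\mathbb R^d)$ is the space of Schwartz functions $\psi$ with $D^\alpha\widehat\psi(0)=0$ for all multi-indices $\alpha$, with the topology induced by $\mathcal S(\mathbb R^d)$, and $\dot{\mathcal S}'(\mathbb R^d)$ is its dual (tempered distributions modulo polynomials). The generator $\varphi\in C_c^\infty(\mathbb R^d)$ is any radial function with $\operatorname{supp}\varphi\subset\{\frac34<|\xi|<\frac74\}$, $\varphi=1$ on $\{\frac78<|\xi|<\frac98\}$ and $\sum_{j\in\mathbb Z}\varphi(2^{-j}\xi)=1$ for $\xi\ne0$; for $u\in\dot{\mathcal S}'(\mathbb R^d)$, $\dot\Delta_ju$ is the tempered distribution with $\widehat{\dot\Delta_j u}=\varphi(2^{-j}\cdot)\,\widehat u$, and $\dot B^{-1}_{\infty,1}(\mathbb R^d)$ is the space of $u\in\dot{\mathcal S}'(\mathbb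 R^d)$ with $$\|u\|_{\dot B^{-1}_{\infty,1}}=\sum_{j\in\mathbb Z}2^{-j}\|\dot\Delta_j u\|_{L^\infty(\mathbb R^d)}<\infty .$$ -/

import Mathlib

open MeasureTheory FourierTransform
open scoped ENNReal NNReal SchwartzMap ContDiff

noncomputable section

namespace BMOEmbedding

/-- Euclidean space `ℝ^d`. -/
abbrev E (d : ℕ) : Type := EuclideanSpace ℝ (Fin d)

/-! ### Mean oscillation -/

/-- The closed cube with centre `c`, side length `ℓ` and sides parallel to the axes. -/
def cube {d : ℕ} (c : E d) (ℓ : ℝ) : Set (E d) := {x | ∀ i, |x i - c i| ≤ ℓ / 2}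

/-- The mean `|Q|⁻¹ ∫_Q |f|`. -/
def meanNorm {d : ℕ} (f : E d → ℂ) (Q : Set (E d)) : ℝ≥0∞ :=
  (volume Q)⁻¹ * ∫⁻ x in Q, ‖f x‖ₑ

/-- The mean oscillation `|Q|⁻¹ ∫_Q |f - f_Q|`, where `f_Q = |Q|⁻¹ ∫_Q f`. -/
def meanOsc {d : ℕ} (f : E d → ℂ) (Q : Set (E d)) : ℝ≥0∞ :=
  meanNorm (fun x => f x - ⨍ y in Q, f y) Q

/-- The `BMO` seminorm: the supremum of the mean oscillations over all cubes. -/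
def BMOSeminorm {d : ℕ} (f : E d → ℂ) : ℝ≥0∞ :=
  ⨆ (c : E d) (ℓ : ℝ) (_ : 0 < ℓ), meanOsc f (cube c ℓ)

/-- `f ∈ BMO(ℝ^d)`. -/
def MemBMO {d : ℕ} (f : E d → ℂ) : Prop :=
  LocallyIntegrable f volume ∧ BMOSeminorm f < ⊤

/-- The norm of the local space `bmo`: mean oscillations over the cubes of side length
smaller than `1`, and means of `|f|` over the cubes of side length at least `1`. -/
def bmoNorm {d : ℕ} (f : E d → ℂ) : ℝ≥0∞ :=
  (⨆ (c : E d) (ℓ : ℝ) (_ : 0 < ℓ) (_ : ℓ < 1), meanOsc f (cube c ℓ)) +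
    ⨆ (c : E d) (ℓ : ℝ) (_ : 1 ≤ ℓ), meanNorm f (cube c ℓ)

/-- `f ∈ bmo(ℝ^d)`. -/
def Membmo {d : ℕ} (f : E d → ℂ) : Prop :=
  LocallyIntegrable f volume ∧ bmoNorm f < ⊤

/-! ### Distributions modulo polynomials -/

/-- The space of Schwartz functions all of whose Fourier transform's derivatives vanish at `0`.
As a submodule of `𝓢(ℝ^d)` it carries the induced topology. -/
def dotSchwartz (d : ℕ) : Submodule ℂ 𝓢(E d, ℂ) where
  carrier := {ψ | ∀ n : ℕ, iteratedFDeriv ℝ n (𝓕 ψ : 𝓢(E d, ℂ)) 0 = 0}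
  zero_mem' := fun n => by
    have h : ((𝓕 (0 : 𝓢(E d, ℂ)) : 𝓢(E d, ℂ)) : E d → ℂ) = 0 := by
      rw [FourierTransform.fourier_zero]; rfl
    rw [h]
    simp
  add_mem' := fun {f g} hf hg n => by
    have h : ((𝓕 (f + g) : 𝓢(E d, ℂ)) : E d → ℂ)
        = (𝓕 f : 𝓢(E d, ℂ)) + (𝓕 g : 𝓢(E d, ℂ)) := by
      rw [FourierTransform.fourier_add]; rfl
    rw [h, iteratedFDeriv_add (((𝓕 f : 𝓢(E d, ℂ)).smooth n))
      (((𝓕 g : 𝓢(E d, ℂ)).smooth n)), Pi.add_apply, hf n, hg n, add_zero]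
  smul_mem' := fun c f hf n => by
    have h : ((𝓕 (c • f) : 𝓢(E d, ℂ)) : E d → ℂ) = c • ((𝓕 f : 𝓢(E d, ℂ)) : E d → ℂ) := by
      rw [FourierTransform.fourier_smul]; rfl
    rw [h, iteratedFDeriv_const_smul_apply (((𝓕 f : 𝓢(E d, ℂ)).smooth n).contDiffAt), hf n,
      smul_zero]

/-- The topological dual of `dotSchwartz d`, that is, tempered distributions modulo
polynomials. -/
abbrev DotDistribution (d : ℕ) : Type := dotSchwartz d →L[ℂ] ℂ

/-- The function `f` defines the element `u` of the dual of `dotSchwartz d` by integration. -/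
def Represents {d : ℕ} (f : E d → ℂ) (u : DotDistribution d) : Prop :=
  ∀ ψ : dotSchwartz d,
    Integrable (fun x => (ψ : 𝓢(E d, ℂ)) x * f x) volume ∧
      u ψ = ∫ x, (ψ : 𝓢(E d, ℂ)) x * f x

/-! ### Littlewood-Paley decomposition and the homogeneous Besov space -/

/-- A generator of a homogeneous dyadic resolution of unity. -/
structure DyadicGenerator (d : ℕ) where
  /-- the underlying function -/
  toFun : E d → ℂ
  smooth : ContDiff ℝ ∞ toFun
  radial : ∀ ξ η, ‖ξ‖ = ‖η‖ → toFun ξ = toFun η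
  support_subset : tsupport toFun ⊆ {ξ | 3 / 4 < ‖ξ‖ ∧ ‖ξ‖ < 7 / 4}
  eq_one : ∀ ξ, 7 / 8 < ‖ξ‖ → ‖ξ‖ < 9 / 8 → toFun ξ = 1
  hasSum_one : ∀ ξ, ξ ≠ 0 → HasSum (fun j : ℤ => toFun ((2 : ℝ) ^ (-j) • ξ)) 1

/-- The dilated function `ξ ↦ φ(2^{-j} ξ)`. -/
def DyadicGenerator.dilate {d : ℕ} (φ : DyadicGenerator d) (j : ℤ) (ξ : E d) : ℂ :=
  φ.toFun ((2 : ℝ) ^ (-j) • ξ)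

lemma DyadicGenerator.hasTemperateGrowth_dilate {d : ℕ} (φ : DyadicGenerator d) (j : ℤ) :
    (φ.dilate j).HasTemperateGrowth := by
  have hc : HasCompactSupport φ.toFun := by
    refine HasCompactSupport.of_support_subset_isCompact
      (isCompact_closedBall (0 : E d) (7 / 4)) ?_
    intro ξ hξ
    simpa using (φ.support_subset (subset_tsupport _ hξ)).2.le
  have h1 : HasCompactSupport (φ.dilate j) :=
    hc.comp_homeomorph (Homeomorph.smulOfNeZero ((2 : ℝ) ^ (-j)) (by positivity))
  have h2 : ContDiff ℝ ∞ (φ.dilate j) :=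
    φ.smooth.comp (contDiff_const_smul ((2 : ℝ) ^ (-j)))
  exact (h1.toSchwartzMap h2).hasTemperateGrowth

lemma DyadicGenerator.dilate_eq_zero {d : ℕ} (φ : DyadicGenerator d) (j : ℤ) (ξ : E d)
    (h : ‖ξ‖ < 2 ^ j * (3 / 4)) : φ.dilate j ξ = 0 := by
  by_contra hne
  have h3 := (φ.support_subset (subset_tsupport _ hne)).1
  rw [norm_smul, Real.norm_of_nonneg (by positivity), zpow_neg, lt_inv_mul_iff₀ (by positivity)]
    at h3
  exact absurd h (not_lt.mpr h3.le)

/-- The operator with symbol `φ(2^{-j} ·)`, transposed: `ψ ↦ 𝓕 (φ(2^{-j} ·) 𝓕⁻¹ ψ)`. -/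
def DyadicGenerator.transpose {d : ℕ} (φ : DyadicGenerator d) (j : ℤ) :
    𝓢(E d, ℂ) →L[ℂ] 𝓢(E d, ℂ) :=
  fourierCLM ℂ 𝓢(E d, ℂ) ∘L SchwartzMap.smulLeftCLM ℂ (φ.dilate j) ∘L
    fourierInvCLM ℂ 𝓢(E d, ℂ)

lemma DyadicGenerator.transpose_mem {d : ℕ} (φ : DyadicGenerator d) (j : ℤ) (ψ : 𝓢(E d, ℂ)) :
    φ.transpose j ψ ∈ dotSchwartz d := by
  intro n
  set g : 𝓢(E d, ℂ) := SchwartzMap.smulLeftCLM ℂ (φ.dilate j) (𝓕⁻ ψ) with hg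
  have h0 : ∀ x, (𝓕 (φ.transpose j ψ) : 𝓢(E d, ℂ)) x = g (-x) := by
    intro x
    have h1 : φ.transpose j ψ = 𝓕 g := rfl
    have h2 : (𝓕⁻ (𝓕 g) : 𝓢(E d, ℂ)) (-x) = (𝓕 (𝓕 g) : 𝓢(E d, ℂ)) x := by
      rw [SchwartzMap.fourierInv_apply_eq]
      simp
    rw [h1, ← h2, FourierTransform.fourierInv_fourier_eq]
  have h3 : ((𝓕 (φ.transpose j ψ) : 𝓢(E d, ℂ)) : E d → ℂ) =ᶠ[nhds 0] fun _ => (0 : ℂ) := by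
    filter_upwards [Metric.ball_mem_nhds (0 : E d)
      (show (0 : ℝ) < 2 ^ j * (3 / 4) by positivity)] with x hx
    rw [h0, hg, SchwartzMap.smulLeftCLM_apply_apply (φ.hasTemperateGrowth_dilate j),
      φ.dilate_eq_zero j (-x) (by simpa using hx), zero_smul]
  rw [(Filter.EventuallyEq.iteratedFDeriv ℝ h3 n).eq_of_nhds]
  exact congrFun iteratedFDeriv_fun_zero 0

/-- The homogeneous dyadic block `Δ_j u`, the tempered distribution with Fourier transform
`φ(2^{-j} ·) û`; that is, `⟨Δ_j u, ψ⟩ = ⟨u, 𝓕 (φ(2^{-j} ·) 𝓕⁻¹ ψ)⟩`. -/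
def DyadicGenerator.block {d : ℕ} (φ : DyadicGenerator d) (j : ℤ) (u : DotDistribution d) :
    𝓢(E d, ℂ) →L[ℂ] ℂ :=
  u ∘L (φ.transpose j).codRestrict (dotSchwartz d) (φ.transpose_mem j)

/-- The `L^∞` norm of a tempered distribution; it is `∞` if the distribution is not given by an
essentially bounded function. -/
def linftyNorm {d : ℕ} (T : 𝓢(E d, ℂ) →L[ℂ] ℂ) : ℝ≥0∞ :=
  ⨅ (g : E d → ℂ) (_ : MemLp g ⊤ volume) (_ : ∀ ψ : 𝓢(E d, ℂ), T ψ = ∫ x, ψ x * g x),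
    eLpNorm g ⊤ volume

/-- The norm of the homogeneous Besov space `Ḃ^β_{∞,1}`:
`∑_{j ∈ ℤ} 2^{jβ} ‖Δ_j u‖_{L^∞}`. -/
def besovNorm {d : ℕ} (φ : DyadicGenerator d) (β : ℝ) (u : DotDistribution d) : ℝ≥0∞ :=
  ∑' j : ℤ, ENNReal.ofReal ((2 : ℝ) ^ ((j : ℝ) * β)) * linftyNorm (φ.block j u)

/-- `u ∈ Ḃ^β_{∞,1}(ℝ^d)`. -/
def MemBesov {d : ℕ} (φ : DyadicGenerator d) (β : ℝ) (u : DotDistribution d) : Prop :=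
  besovNorm φ β u < ⊤

end BMOEmbedding

end

namespace BMOEmbedding

variable {d : ℕ}

/-! On cubes of side at least `1` the oscillation is at most twice the mean of `|f|`, so `bmo`
embeds in `BMO`. The Besov norm is split at frequency `1`.

For `j ≥ 0` the kernel of the block has integral zero, so the average of `f` over a cube of side
`2^{-j}` may be subtracted from `f`. Averages over successively doubled cubes drift only linearly in
the number of doublings, and the kernel's decay absorbs this. Hence `‖Δ_j f‖_∞ ≲ ‖f‖_BMO` uniformly
in `j` (`exists_enorm_blockFun_le_BMOSeminorm`), and the weights `2^{-j}` are summable.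

For `j < 0`, Hölder and scaling give `‖Δ_j f‖_∞ ≲ 2^{jd/p} ‖f‖_p` (`enorm_blockFun_le`). The
weighted terms are `2^{j(d/p-1)}`, summable as `j → -∞` exactly because `p < d`.

Injectivity holds because `L^p` on a space of infinite measure contains no nonzero constant. -/

/-! ### Cubes and their volumes -/

lemma cube_eq_preimage (c : E d) (ℓ : ℝ) :
    cube c ℓ = (WithLp.ofLp : E d → (Fin d → ℝ)) ⁻¹'
      Set.Icc (fun i => c i - ℓ / 2) (fun i => c i + ℓ / 2) := by
  ext x
  simp only [cube, Set.mem_ofPred_eq, Set.mem_preimage, Set.mem_Icc, Pi.le_def, abs_le]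
  rw [← forall_and]
  refine forall_congr' fun i => ?_
  constructor <;> rintro ⟨h, h'⟩ <;> constructor <;> linarith

lemma measurableSet_cube (c : E d) (ℓ : ℝ) : MeasurableSet (cube c ℓ) := by
  rw [cube_eq_preimage]
  exact (PiLp.volume_preserving_ofLp (Fin d)).measurable measurableSet_Icc

lemma volume_cube (c : E d) (ℓ : ℝ) : volume (cube c ℓ) = ENNReal.ofReal ℓ ^ d := by
  rw [cube_eq_preimage, (PiLp.volume_preserving_ofLp (Fin d)).measure_preimage
    measurableSet_Icc.nullMeasurableSet, Real.volume_Icc_pi]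
  simp

lemma volume_cube_ne_zero (c : E d) {ℓ : ℝ} (hℓ : 0 < ℓ) : volume (cube c ℓ) ≠ 0 := by
  rw [volume_cube]
  exact pow_ne_zero _ (by simpa using hℓ)

lemma volume_cube_ne_top (c : E d) (ℓ : ℝ) : volume (cube c ℓ) ≠ ⊤ := by
  rw [volume_cube]
  exact ENNReal.pow_ne_top ENNReal.ofReal_ne_top

lemma cube_subset_cube (c : E d) {ℓ ℓ' : ℝ} (h : ℓ ≤ ℓ') : cube c ℓ ⊆ cube c ℓ' :=
  fun _ hx i => (hx i).trans (by linarith)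

lemma integrableOn_cube {f : E d → ℂ} (hf : LocallyIntegrable f volume) (c : E d) (ℓ : ℝ) :
    IntegrableOn f (cube c ℓ) volume := by
  refine (hf.integrableOn_isCompact (isCompact_closedBall c (√(d * (ℓ / 2) ^ 2)))).mono_set ?_
  intro x hx
  rw [mem_closedBall_iff_norm, EuclideanSpace.norm_eq]
  refine Real.sqrt_le_sqrt ?_
  calc ∑ i, ‖(x - c) i‖ ^ 2 ≤ ∑ _i : Fin d, (ℓ / 2) ^ 2 := by
        refine Finset.sum_le_sum fun i _ => ?_
        have := hx i
        gcongr
        simpa using this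
    _ = _ := by simp

/-! ### Means and oscillations over cubes -/

lemma lintegral_eq_volume_mul_meanNorm (f : E d → ℂ) {Q : Set (E d)} (h0 : volume Q ≠ 0)
    (ht : volume Q ≠ ⊤) : ∫⁻ x in Q, ‖f x‖ₑ = volume Q * meanNorm f Q := by
  rw [meanNorm, ← mul_assoc, ENNReal.mul_inv_cancel h0 ht, one_mul]

lemma enorm_average_le_meanNorm (f : E d → ℂ) (Q : Set (E d)) :
    ‖⨍ y in Q, f y‖ₑ ≤ meanNorm f Q := by
  rw [average]
  refine (enorm_integral_le_lintegral_enorm _).trans ?_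
  rw [lintegral_smul_measure]
  simp [meanNorm]

lemma meanNorm_sub_const_le (f : E d → ℂ) (a b : ℂ) {Q : Set (E d)} (h0 : volume Q ≠ 0)
    (ht : volume Q ≠ ⊤) :
    meanNorm (fun x => f x - a) Q ≤ meanNorm (fun x => f x - b) Q + ‖b - a‖ₑ := by
  calc meanNorm (fun x => f x - a) Q
      ≤ (volume Q)⁻¹ * ∫⁻ x in Q, (‖f x - b‖ₑ + ‖b - a‖ₑ) := by
        unfold meanNorm
        gcongr with x
        calc ‖f x - a‖ₑ = ‖(f x - b) + (b - a)‖ₑ := by ring_nf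
          _ ≤ _ := enorm_add_le _ _
    _ = _ := by
        rw [lintegral_add_right _ measurable_const, mul_add, setLIntegral_const,
          mul_comm ‖b - a‖ₑ, ← mul_assoc, ENNReal.inv_mul_cancel h0 ht, one_mul]
        rfl

lemma meanOsc_le_two_mul_meanNorm (f : E d → ℂ) {Q : Set (E d)} (h0 : volume Q ≠ 0)
    (ht : volume Q ≠ ⊤) : meanOsc f Q ≤ 2 * meanNorm f Q := by
  have h := meanNorm_sub_const_le f (⨍ y in Q, f y) 0 h0 ht
  simp only [sub_zero, zero_sub, enorm_neg] at h
  rw [two_mul]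
  exact h.trans (by gcongr; exact enorm_average_le_meanNorm f Q)

lemma BMOSeminorm_le_two_mul_bmoNorm (f : E d → ℂ) : BMOSeminorm f ≤ 2 * bmoNorm f := by
  refine iSup_le fun c => iSup_le fun ℓ => iSup_le fun hℓ => ?_
  rcases lt_or_ge ℓ 1 with h | h
  · have h1 : meanOsc f (cube c ℓ) ≤ bmoNorm f := by
      refine le_trans ?_ le_self_add
      exact le_iSup_of_le c (le_iSup_of_le ℓ (le_iSup_of_le hℓ (le_iSup_of_le h le_rfl)))
    rw [two_mul]
    exact h1.trans le_self_add
  · refine (meanOsc_le_two_mul_meanNorm f (volume_cube_ne_zero c hℓ)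
      (volume_cube_ne_top c ℓ)).trans ?_
    gcongr
    refine le_trans ?_ le_add_self
    exact le_iSup_of_le c (le_iSup_of_le ℓ (le_iSup_of_le h le_rfl))

lemma meanOsc_le_BMOSeminorm (f : E d → ℂ) (c : E d) {ℓ : ℝ} (hℓ : 0 < ℓ) :
    meanOsc f (cube c ℓ) ≤ BMOSeminorm f :=
  le_iSup_of_le c (le_iSup_of_le ℓ (le_iSup_of_le hℓ le_rfl))

lemma meanNorm_cube_le_doubled (f : E d → ℂ) (c : E d) {ℓ : ℝ} (hℓ : 0 < ℓ) :
    meanNorm f (cube c ℓ) ≤ 2 ^ d * meanNorm f (cube c (2 * ℓ)) := by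
  have h2 : (volume (cube c (2 * ℓ)))⁻¹ = (2 ^ d)⁻¹ * (volume (cube c ℓ))⁻¹ := by
    rw [volume_cube, volume_cube, ENNReal.ofReal_mul (by norm_num), mul_pow,
      ENNReal.mul_inv (by simp) (by simp)]
    simp
  rw [meanNorm, meanNorm, h2, ← mul_assoc, ← mul_assoc,
    ENNReal.mul_inv_cancel (by simp) (by simp), one_mul]
  gcongr
  exact cube_subset_cube c (by linarith)

/-- The difference is, up to sign, the average over the small cube of `f` minus its mean on the
doubled cube; enlarging the domain of integration costs the volume ratio `2^d`. -/
lemma enorm_average_sub_average_doubled_le {f : E d → ℂ} (hf : LocallyIntegrable f volume)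
    (c : E d) {ℓ : ℝ} (hℓ : 0 < ℓ) :
    ‖(⨍ y in cube c (2 * ℓ), f y) - ⨍ y in cube c ℓ, f y‖ₑ ≤ 2 ^ d * BMOSeminorm f := by
  set a := ⨍ y in cube c (2 * ℓ), f y with ha
  have h0 := volume_cube_ne_zero c hℓ
  have ht := volume_cube_ne_top c ℓ
  have h1 : (⨍ y in cube c ℓ, (f y - a)) = (⨍ y in cube c ℓ, f y) - a := by
    rw [setAverage_eq, setAverage_eq,
      integral_sub (integrableOn_cube hf c ℓ) (integrable_const_iff.2 (Or.inr
        ⟨by simpa using ht.lt_top⟩)), smul_sub]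
    congr 1
    rw [setIntegral_const, smul_smul, inv_mul_cancel₀, one_smul]
    exact (ENNReal.toReal_pos h0 ht).ne'
  rw [enorm_sub_rev, ← h1]
  refine (enorm_average_le_meanNorm _ _).trans ((meanNorm_cube_le_doubled _ c hℓ).trans ?_)
  gcongr
  exact meanOsc_le_BMOSeminorm f c (by positivity)

/-- Telescoping over `k` doublings, each costing `2^d` times the seminorm. The growth is linear in
`k`, hence harmless against geometric decay. -/
lemma meanNorm_sub_average_cube_pow_le {f : E d → ℂ} (hf : LocallyIntegrable f volume)
    (c : E d) {ℓ : ℝ} (hℓ : 0 < ℓ) (k : ℕ) :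
    meanNorm (fun x => f x - ⨍ y in cube c ℓ, f y) (cube c (2 ^ k * ℓ)) ≤
      (1 + k * 2 ^ d) * BMOSeminorm f := by
  have h1 : ‖(⨍ y in cube c (2 ^ k * ℓ), f y) - ⨍ y in cube c ℓ, f y‖ₑ ≤
      (k * 2 ^ d) * BMOSeminorm f := by
    induction k with
    | zero => simp
    | succ k ih =>
      have h2 := enorm_average_sub_average_doubled_le hf c (ℓ := 2 ^ k * ℓ) (by positivity)
      rw [← mul_assoc, ← pow_succ'] at h2
      rw [← sub_add_sub_cancel _ (⨍ y in cube c (2 ^ k * ℓ), f y)]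
      refine (enorm_add_le _ _).trans ((add_le_add h2 ih).trans (le_of_eq ?_))
      push_cast
      ring
  refine (meanNorm_sub_const_le f _ (⨍ y in cube c (2 ^ k * ℓ), f y)
    (volume_cube_ne_zero c (by positivity)) (volume_cube_ne_top c _)).trans ?_
  rw [add_mul, one_mul]
  exact add_le_add (meanOsc_le_BMOSeminorm f c (by positivity)) h1

/-! ### Integrals of decaying kernels against the oscillation -/

/-- The constant in the estimate of a convolution by the mean oscillation. -/
noncomputable def oscConst (d : ℕ) : ℝ≥0∞ := ∑' k : ℕ, (2⁻¹ : ℝ≥0∞) ^ k * (1 + k * 2 ^ d)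

lemma oscConst_ne_top (d : ℕ) : oscConst d ≠ ⊤ := by
  have h1 : Summable fun k : ℕ => ((2⁻¹ : ℝ≥0) ^ k * (1 + k * 2 ^ d) : ℝ≥0) := by
    rw [← NNReal.summable_coe]
    have h2 := summable_geometric_of_lt_one (r := (2⁻¹ : ℝ)) (by norm_num) (by norm_num)
    have h3 := (summable_pow_mul_geometric_of_norm_lt_one (R := ℝ) 1 (r := 2⁻¹)
      (by norm_num)).mul_left (2 ^ d)
    refine (h2.add h3).congr fun k => ?_
    push_cast
    ring
  have h2 := ENNReal.tsum_coe_ne_top_iff_summable.2 h1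
  convert h2 using 1
  refine tsum_congr fun k => ?_
  push_cast
  simp

/-- The `k`-th cube has volume `2^{kd} r^d` and weight `2^{-k(d+1)}`. The product leaves `2^{-k}`,
which is summable against the linear growth of the mean of `|f - a|`. -/
lemma lintegral_kernel_mul_enorm_sub_average_le {f : E d → ℂ} (hf : LocallyIntegrable f volume)
    {h : E d → ℝ≥0∞} {A : ℝ≥0∞} {r : ℝ} (hr : 0 < r)
    (hh : ∀ z, h z ≤ ∑' k : ℕ, (cube (0 : E d) (2 ^ k * r)).indicator
      (fun _ => A * 2⁻¹ ^ (k * (d + 1))) z) (x : E d) :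
    ∫⁻ y, h (y - x) * ‖f y - ⨍ t in cube x r, f t‖ₑ ≤
      A * ENNReal.ofReal r ^ d * (oscConst d * BMOSeminorm f) := by
  set a := ⨍ t in cube x r, f t
  have hm : AEMeasurable (fun y => ‖f y - a‖ₑ) volume :=
    (hf.aestronglyMeasurable.sub aestronglyMeasurable_const).enorm
  have hx : ∀ (k : ℕ) (y : E d),
      (cube (0 : E d) (2 ^ k * r)).indicator (fun _ => A * 2⁻¹ ^ (k * (d + 1))) (y - x) *
        ‖f y - a‖ₑ =
      (cube x (2 ^ k * r)).indicator (fun y => A * 2⁻¹ ^ (k * (d + 1)) * ‖f y - a‖ₑ) y := by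
    intro k y
    have : y - x ∈ cube (0 : E d) (2 ^ k * r) ↔ y ∈ cube x (2 ^ k * r) := by simp [cube]
    by_cases hy : y ∈ cube x (2 ^ k * r)
    · rw [Set.indicator_of_mem hy, Set.indicator_of_mem (this.2 hy)]
    · rw [Set.indicator_of_notMem hy, Set.indicator_of_notMem (mt this.1 hy), zero_mul]
  calc ∫⁻ y, h (y - x) * ‖f y - a‖ₑ
      ≤ ∫⁻ y, ∑' k : ℕ, (cube x (2 ^ k * r)).indicator
          (fun y => A * 2⁻¹ ^ (k * (d + 1)) * ‖f y - a‖ₑ) y := by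
        refine lintegral_mono fun y => ?_
        simp_rw [← hx, ENNReal.tsum_mul_right]
        gcongr
        exact hh _
    _ = ∑' k : ℕ, ∫⁻ y, (cube x (2 ^ k * r)).indicator
          (fun y => A * 2⁻¹ ^ (k * (d + 1)) * ‖f y - a‖ₑ) y :=
        lintegral_tsum fun k => (hm.const_mul _).indicator (measurableSet_cube _ _)
    _ ≤ ∑' k : ℕ, A * ENNReal.ofReal r ^ d *
          (2⁻¹ ^ k * (1 + k * 2 ^ d) * BMOSeminorm f) := by
        refine ENNReal.tsum_le_tsum fun k => ?_
        rw [lintegral_indicator (measurableSet_cube _ _), lintegral_const_mul'' _ hm.restrict,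
          lintegral_eq_volume_mul_meanNorm (fun y => f y - a)
            (volume_cube_ne_zero x (by positivity)) (volume_cube_ne_top x _), volume_cube,
          ENNReal.ofReal_mul (by positivity), mul_pow, ENNReal.ofReal_pow (by norm_num),
          ENNReal.ofReal_ofNat, ← pow_mul]
        have h1 : (2⁻¹ : ℝ≥0∞) ^ (k * (d + 1)) * 2 ^ (k * d) = 2⁻¹ ^ k := by
          rw [mul_add, mul_one, pow_add, mul_right_comm, ← mul_pow,
            ENNReal.inv_mul_cancel (by simp) (by simp), one_pow, one_mul]
        calc _ = A * ENNReal.ofReal r ^ d * ((2⁻¹ ^ (k * (d + 1)) * 2 ^ (k * d)) *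
              meanNorm (fun y => f y - a) (cube x (2 ^ k * r))) := by ring
          _ ≤ _ := by
            rw [h1, mul_assoc (2⁻¹ ^ k)]
            gcongr
            exact meanNorm_sub_average_cube_pow_le hf x hr k
    _ = _ := by
        rw [ENNReal.tsum_mul_left, ENNReal.tsum_mul_right, oscConst]

/-- Decay of order `(1 + ‖z‖)^{-(d+1)}` suffices: at each `z` a single term of the series, for a
cube of size comparable to `1 + ‖z‖`, already dominates. -/
lemma exists_enorm_schwartz_le_tsum (H : 𝓢(E d, ℂ)) : ∃ A : ℝ≥0, ∀ z, ‖H z‖ₑ ≤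
    ∑' k : ℕ, (cube (0 : E d) (2 ^ k)).indicator
      (fun _ => (A : ℝ≥0∞) * 2⁻¹ ^ (k * (d + 1))) z := by
  obtain ⟨C, hC0, hC⟩ : ∃ C : ℝ, 0 ≤ C ∧ ∀ z, (1 + ‖z‖) ^ (d + 1) * ‖H z‖ ≤ C := by
    refine ⟨2 ^ (d + 1) * ((Finset.Iic (d + 1, 0)).sup
      (fun m => SchwartzMap.seminorm ℝ m.1 m.2)) H, by positivity, fun z => ?_⟩
    simpa using SchwartzMap.one_add_le_sup_seminorm_apply (𝕜 := ℝ) (m := (d + 1, 0))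
      (k := d + 1) (n := 0) le_rfl le_rfl H z
  refine ⟨Real.toNNReal (4 ^ (d + 1) * C), fun z => ?_⟩
  have hex : ∃ k : ℕ, ‖z‖ ≤ 2 ^ k / 2 := by
    obtain ⟨k, hk⟩ := pow_unbounded_of_one_lt (2 * ‖z‖) (one_lt_two (α := ℝ))
    exact ⟨k, by linarith⟩
  classical
  set k := Nat.find hex with hk
  have hkz : ‖z‖ ≤ 2 ^ k / 2 := Nat.find_spec hex
  have hmem : z ∈ cube (0 : E d) (2 ^ k) := fun i => by
    simpa using (PiLp.norm_apply_le z i).trans hkz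
  -- Minimality of `k` gives `2^{k-1}/2 < ‖z‖` when `k > 0`; the summand `1` covers `k = 0`.
  have hlow : (2 : ℝ) ^ k ≤ 4 * (1 + ‖z‖) := by
    rcases Nat.eq_zero_or_pos k with h0 | h0
    · rw [h0, pow_zero]; linarith [norm_nonneg z]
    · have h1 := Nat.find_min hex (m := k - 1) (by omega)
      have h2 : (2 : ℝ) ^ k = 2 * 2 ^ (k - 1) := by
        rw [← pow_succ', Nat.sub_add_cancel h0]
      rw [h2]
      linarith [not_le.1 h1]
  refine le_trans ?_ (ENNReal.le_tsum k)
  rw [Set.indicator_of_mem hmem]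
  have hreal : ‖H z‖ ≤ 4 ^ (d + 1) * C * 2⁻¹ ^ (k * (d + 1)) := by
    rw [inv_pow, ← div_eq_mul_inv, le_div_iff₀ (by positivity)]
    calc ‖H z‖ * 2 ^ (k * (d + 1)) = (2 ^ k) ^ (d + 1) * ‖H z‖ := by rw [pow_mul, mul_comm]
      _ ≤ (4 * (1 + ‖z‖)) ^ (d + 1) * ‖H z‖ := by gcongr
      _ = 4 ^ (d + 1) * ((1 + ‖z‖) ^ (d + 1) * ‖H z‖) := by rw [mul_pow, mul_assoc]
      _ ≤ _ := by gcongr; exact hC z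
  rw [← ofReal_norm]
  refine (ENNReal.ofReal_le_ofReal hreal).trans (le_of_eq ?_)
  rw [ENNReal.ofReal_mul (by positivity), ENNReal.ofReal_pow (by positivity),
    ENNReal.ofReal_inv_of_pos (by positivity), ENNReal.ofReal_ofNat]
  rfl

/-! ### Kernels of the dyadic blocks -/

lemma eLpNorm_comp_pos_smul {F : E d → ℂ} (hF : AEStronglyMeasurable F volume) {r : ℝ}
    (hr : 0 < r) {q : ℝ≥0∞} (hq : q ≠ ⊤) :
    eLpNorm (fun z => F (r • z)) q volume =
      ENNReal.ofReal (r ^ (-(d : ℝ) * (1 / q).toReal)) * eLpNorm F q volume := by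
  have hmap := Measure.map_addHaar_smul (volume : Measure (E d)) hr.ne'
  rw [finrank_euclideanSpace, Fintype.card_fin] at hmap
  have h1 : eLpNorm (F ∘ fun z => r • z) q volume =
      eLpNorm F q (Measure.map (r • ·) (volume : Measure (E d))) :=
    (eLpNorm_map_measure (by rw [hmap]; exact hF.smul_measure _) (by fun_prop)).symm
  change eLpNorm (F ∘ fun z => r • z) q volume = _
  rw [h1, hmap, eLpNorm_smul_measure_of_ne_top hq, smul_eq_mul,
    abs_of_pos (by positivity), ENNReal.ofReal_rpow_of_pos (by positivity),
    Real.rpow_mul hr.le, Real.rpow_neg hr.le, Real.rpow_natCast]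

/-- The dilated generator `φ(2^{-j} ·)` as a Schwartz function. -/
noncomputable def DyadicGenerator.schwartz (φ : DyadicGenerator d) (j : ℤ) : 𝓢(E d, ℂ) :=
  HasCompactSupport.toSchwartzMap (f := φ.dilate j)
    ((HasCompactSupport.of_support_subset_isCompact (isCompact_closedBall (0 : E d) (7 / 4))
      (fun ξ hξ => by simpa using (φ.support_subset (subset_tsupport _ hξ)).2.le)).comp_homeomorph
        (Homeomorph.smulOfNeZero ((2 : ℝ) ^ (-j)) (by positivity)))
    (φ.smooth.comp (contDiff_const_smul ((2 : ℝ) ^ (-j))))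

@[simp]
lemma DyadicGenerator.schwartz_apply (φ : DyadicGenerator d) (j : ℤ) (ξ : E d) :
    φ.schwartz j ξ = φ.dilate j ξ := rfl

/-- The convolution kernel of the dyadic block, reflected at the origin. -/
noncomputable def DyadicGenerator.kernel (φ : DyadicGenerator d) (j : ℤ) : 𝓢(E d, ℂ) :=
  𝓕 (φ.schwartz j)

lemma DyadicGenerator.kernel_eq (φ : DyadicGenerator d) (j : ℤ) (z : E d) :
    φ.kernel j z = ((2 : ℝ) ^ j) ^ d • φ.kernel 0 ((2 : ℝ) ^ j • z) := by
  have h : ∀ i : ℤ, ∀ w : E d, φ.kernel i w = ∫ ξ, Real.fourierChar (-inner ℝ ξ w) •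
      φ.dilate i ξ := fun i w => by
    rw [DyadicGenerator.kernel, SchwartzMap.fourier_coe, Real.fourier_eq]
    rfl
  rw [h, h]
  have h2 := Measure.integral_comp_inv_smul_of_nonneg (volume : Measure (E d))
    (fun ξ => Real.fourierChar (-inner ℝ ξ ((2 : ℝ) ^ j • z)) • φ.dilate 0 ξ)
    (R := (2 : ℝ) ^ j) (by positivity)
  rw [finrank_euclideanSpace, Fintype.card_fin] at h2
  rw [← h2]
  refine integral_congr_ae (Filter.Eventually.of_forall fun ξ => ?_)
  have h3 : inner ℝ (((2 : ℝ) ^ j)⁻¹ • ξ) ((2 : ℝ) ^ j • z) = inner ℝ ξ z := by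
    rw [real_inner_smul_left, real_inner_smul_right, inv_mul_cancel_left₀ (by positivity)]
  simp only [h3]
  simp [DyadicGenerator.dilate]

/-- The integral is the value of the symbol at the origin, where it vanishes. -/
lemma DyadicGenerator.integral_kernel (φ : DyadicGenerator d) (j : ℤ) :
    ∫ z, φ.kernel j z = 0 := by
  have h : (𝓕⁻ (φ.kernel j) : 𝓢(E d, ℂ)) 0 = ∫ z, φ.kernel j z := by
    rw [SchwartzMap.fourierInv_coe, Real.fourierInv_eq]
    simp
  rw [← h, DyadicGenerator.kernel, FourierTransform.fourierInv_fourier_eq, φ.schwartz_apply]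
  exact φ.dilate_eq_zero j 0 (by rw [norm_zero]; positivity)

/-- This is the multiplication formula `∫ 𝓕F · η = ∫ F · 𝓕η`, with `F` the modulated symbol and `η`
the reflection of `ψ`, which turns `𝓕⁻ ψ` into `𝓕 η`. -/
lemma DyadicGenerator.transpose_apply (φ : DyadicGenerator d) (j : ℤ) (ψ : 𝓢(E d, ℂ)) (y : E d) :
    φ.transpose j ψ y = ∫ x, ψ x * φ.kernel j (y - x) := by
  have h1 : φ.transpose j ψ y =
      ∫ ξ, (Real.fourierChar (-inner ℝ ξ y) • φ.schwartz j ξ) * (𝓕⁻ ψ : 𝓢(E d, ℂ)) ξ := by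
    change (𝓕 (SchwartzMap.smulLeftCLM ℂ (φ.dilate j) (𝓕⁻ ψ)) : 𝓢(E d, ℂ)) y = _
    rw [SchwartzMap.fourier_coe, Real.fourier_eq]
    refine integral_congr_ae (Filter.Eventually.of_forall fun ξ => ?_)
    simp only [SchwartzMap.smulLeftCLM_apply_apply (φ.hasTemperateGrowth_dilate j),
      φ.schwartz_apply, smul_eq_mul, smul_mul_assoc]
  set η : E d → ℂ := fun x => ψ (-x)
  have hη : Integrable η volume := ψ.integrable.comp_neg
  have h2 : ∀ ξ, (𝓕⁻ ψ : 𝓢(E d, ℂ)) ξ = 𝓕 η ξ := fun ξ => by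
    rw [SchwartzMap.fourierInv_coe, Real.fourierInv_eq_fourier_comp_neg]
  set F : E d → ℂ := fun ξ => Real.fourierChar (-inner ℝ ξ y) • φ.schwartz j ξ
  have hF : Integrable F volume := by
    have := (Real.fourierIntegral_convergent_iff (f := (φ.schwartz j : E d → ℂ)) (μ := volume)
      y).2 (φ.schwartz j).integrable
    exact this
  have h3 : ∫ ξ, 𝓕 F ξ * η ξ = ∫ ξ, F ξ * 𝓕 η ξ := by
    simpa using! VectorFourier.integral_bilin_fourierIntegral_eq_flip
      (ContinuousLinearMap.mul ℂ ℂ) (L := innerₗ (E d)) (μ := volume) (ν := volume)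
      Real.continuous_fourierChar continuous_inner hF hη
  simp_rw [h1, h2]
  rw [← h3, ← integral_neg_eq_self]
  refine integral_congr_ae (Filter.Eventually.of_forall fun x => ?_)
  simp only [η, neg_neg]
  rw [mul_comm]
  congr 1
  rw [DyadicGenerator.kernel, SchwartzMap.fourier_coe, Real.fourier_eq, Real.fourier_eq]
  refine integral_congr_ae (Filter.Eventually.of_forall fun ξ => ?_)
  simp only [F, smul_smul, ← AddChar.map_add_eq_mul]
  congr 2
  rw [inner_sub_right, inner_neg_right]
  ring_nf

/-! ### Pointwise bounds for the blocks -/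

/-- The dyadic block of a function, as an integral. -/
noncomputable def DyadicGenerator.blockFun (φ : DyadicGenerator d) (j : ℤ) (f : E d → ℂ)
    (x : E d) : ℂ := ∫ y, φ.kernel j (y - x) * f y

lemma DyadicGenerator.eLpNorm_kernel_comp_sub (φ : DyadicGenerator d) {p q : ℝ}
    (hpq : p.HolderConjugate q) (j : ℤ) (x : E d) :
    eLpNorm (fun y => φ.kernel j (y - x)) (ENNReal.ofReal q) volume =
      ENNReal.ofReal (((2 : ℝ) ^ j) ^ (d / p)) *
        eLpNorm (φ.kernel 0) (ENNReal.ofReal q) volume := by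
  have h2 : eLpNorm (fun y => φ.kernel j (y - x)) (ENNReal.ofReal q) volume =
      eLpNorm (φ.kernel j) (ENNReal.ofReal q) volume :=
    eLpNorm_comp_measurePreserving (φ.kernel j).continuous.aestronglyMeasurable
      (measurePreserving_sub_right volume x)
  have h3 : (φ.kernel j : E d → ℂ) = (((2 : ℝ) ^ j) ^ d) •
      fun z => φ.kernel 0 ((2 : ℝ) ^ j • z) := funext (φ.kernel_eq j)
  have hr : (0 : ℝ) < 2 ^ j := by positivity
  rw [h2, h3, eLpNorm_const_smul,
    eLpNorm_comp_pos_smul (φ.kernel 0).continuous.aestronglyMeasurable hr ENNReal.ofReal_ne_top,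
    ← mul_assoc]
  congr 1
  rw [Real.enorm_of_nonneg (by positivity), ← ENNReal.ofReal_mul (by positivity),
    ← Real.rpow_natCast, ← Real.rpow_add hr]
  -- The amplitude contributes `d` and the dilation `-d/q`, so the exponent of `2^j` is `d - d/q =
  -- d/p`.
  have h5 : (1 / ENNReal.ofReal q).toReal = 1 - p⁻¹ := by
    rw [one_div, ENNReal.toReal_inv, ENNReal.toReal_ofReal hpq.symm.nonneg,
      hpq.one_sub_inv]
  rw [h5]
  congr 2
  ring

lemma DyadicGenerator.lintegral_kernel_mul_le (φ : DyadicGenerator d) {p q : ℝ}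
    (hpq : p.HolderConjugate q) {f : E d → ℂ} (hf : AEStronglyMeasurable f volume)
    (j : ℤ) (x : E d) :
    ∫⁻ y, ‖φ.kernel j (y - x) * f y‖ₑ ≤ ENNReal.ofReal (((2 : ℝ) ^ j) ^ (d / p)) *
      (eLpNorm (φ.kernel 0) (ENNReal.ofReal q) volume *
        eLpNorm f (ENNReal.ofReal p) volume) := by
  have hk : AEStronglyMeasurable (fun y => φ.kernel j (y - x)) volume :=
    ((φ.kernel j).continuous.comp (by fun_prop)).aestronglyMeasurable
  rw [← mul_assoc, ← φ.eLpNorm_kernel_comp_sub hpq j x, ← eLpNorm_one_eq_lintegral_enorm]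
  exact eLpNorm_smul_le_mul_eLpNorm (φ := fun y => φ.kernel j (y - x)) hf hk
    (hpqr := hpq.symm.ennrealOfReal)

lemma DyadicGenerator.eLpNorm_kernel_lt_top (φ : DyadicGenerator d) (j : ℤ) (q : ℝ≥0∞) :
    eLpNorm (φ.kernel j) q volume < ⊤ :=
  SchwartzMap.eLpNorm_lt_top (φ.kernel j) q volume

lemma DyadicGenerator.exists_enorm_kernel_le_tsum (φ : DyadicGenerator d) :
    ∃ A : ℝ≥0, ∀ (j : ℤ) (z : E d), ‖φ.kernel j z‖ₑ ≤
      ∑' k : ℕ, (cube (0 : E d) (2 ^ k * ((2 : ℝ) ^ j)⁻¹)).indicator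
        (fun _ => (ENNReal.ofReal ((2 : ℝ) ^ j) ^ d * A) * 2⁻¹ ^ (k * (d + 1))) z := by
  obtain ⟨A, hA⟩ := exists_enorm_schwartz_le_tsum (φ.kernel 0)
  refine ⟨A, fun j z => ?_⟩
  have hr : (0 : ℝ) < 2 ^ j := by positivity
  have hmem : ∀ k : ℕ, (2 : ℝ) ^ j • z ∈ cube (0 : E d) (2 ^ k) ↔
      z ∈ cube (0 : E d) (2 ^ k * ((2 : ℝ) ^ j)⁻¹) := fun k => by
    refine forall_congr' fun i => ?_
    simp only [PiLp.smul_apply, PiLp.zero_apply, sub_zero, smul_eq_mul, abs_mul, abs_of_pos hr]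
    rw [← le_div_iff₀' hr]
    ring_nf
  rw [φ.kernel_eq, enorm_smul, Real.enorm_of_nonneg (by positivity), ENNReal.ofReal_pow hr.le]
  refine (mul_le_mul_right (hA _) _).trans (le_of_eq ?_)
  rw [← ENNReal.tsum_mul_left]
  refine tsum_congr fun k => ?_
  by_cases hz : z ∈ cube (0 : E d) (2 ^ k * ((2 : ℝ) ^ j)⁻¹)
  · rw [Set.indicator_of_mem hz, Set.indicator_of_mem ((hmem k).2 hz), mul_assoc]
  · rw [Set.indicator_of_notMem hz, Set.indicator_of_notMem (mt (hmem k).1 hz), mul_zero]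

lemma DyadicGenerator.integrable_kernel_mul (φ : DyadicGenerator d) {p q : ℝ}
    (hpq : p.HolderConjugate q) {f : E d → ℂ} (hf : MemLp f (ENNReal.ofReal p) volume)
    (j : ℤ) (x : E d) : Integrable (fun y => φ.kernel j (y - x) * f y) volume := by
  refine ⟨((φ.kernel j).continuous.comp (by fun_prop)).aestronglyMeasurable.mul hf.1, ?_⟩
  refine (φ.lintegral_kernel_mul_le hpq hf.1 j x).trans_lt ?_
  exact ENNReal.mul_lt_top ENNReal.ofReal_lt_top
    (ENNReal.mul_lt_top (φ.eLpNorm_kernel_lt_top 0 _) hf.2)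

lemma DyadicGenerator.enorm_blockFun_le (φ : DyadicGenerator d) {p q : ℝ}
    (hpq : p.HolderConjugate q) {f : E d → ℂ} (hf : AEStronglyMeasurable f volume)
    (j : ℤ) (x : E d) :
    ‖φ.blockFun j f x‖ₑ ≤ ENNReal.ofReal (((2 : ℝ) ^ j) ^ (d / p)) *
      (eLpNorm (φ.kernel 0) (ENNReal.ofReal q) volume *
        eLpNorm f (ENNReal.ofReal p) volume) :=
  (enorm_integral_le_lintegral_enorm _).trans (φ.lintegral_kernel_mul_le hpq hf j x)

/-- Subtracting the average over the cube of side `2^{-j}`, the scale of the kernel, makes the bound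
independent of `j`. Membership in `L^p` serves only to make the integral of kernel times `f`
converge. -/
lemma DyadicGenerator.exists_enorm_blockFun_le_BMOSeminorm (φ : DyadicGenerator d) {p q : ℝ}
    (hpq : p.HolderConjugate q) : ∃ A : ℝ≥0, ∀ f : E d → ℂ, LocallyIntegrable f volume →
      MemLp f (ENNReal.ofReal p) volume → ∀ (j : ℤ) (x : E d),
        ‖φ.blockFun j f x‖ₑ ≤ A * (oscConst d * BMOSeminorm f) := by
  obtain ⟨A, hA⟩ := φ.exists_enorm_kernel_le_tsum
  refine ⟨A, fun f hf hfp j x => ?_⟩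
  have hr : (0 : ℝ) < 2 ^ j := by positivity
  set a := ⨍ t in cube x ((2 : ℝ) ^ j)⁻¹, f t with ha
  have hk : Integrable (fun y => φ.kernel j (y - x)) volume :=
    (φ.kernel j).integrable.comp_sub_right x
  have h0 : ∫ y, φ.kernel j (y - x) * a = 0 := by
    rw [integral_mul_const, integral_sub_right_eq_self (fun y => φ.kernel j y),
      φ.integral_kernel, zero_mul]
  have h1 : φ.blockFun j f x = ∫ y, φ.kernel j (y - x) * (f y - a) := by
    simp_rw [mul_sub]
    rw [integral_sub (φ.integrable_kernel_mul hpq hfp j x) (hk.mul_const a), h0, sub_zero]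
    rfl
  have h2 := lintegral_kernel_mul_enorm_sub_average_le hf (inv_pos.2 hr) (hA j) x
  -- The kernel's amplitude `2^{jd}` cancels the volume `2^{-jd}` of the cube.
  have h3 : ENNReal.ofReal ((2 : ℝ) ^ j) ^ d * (A : ℝ≥0∞) *
      ENNReal.ofReal (((2 : ℝ) ^ j)⁻¹) ^ d = A := by
    rw [mul_right_comm, ← mul_pow, ← ENNReal.ofReal_mul hr.le, mul_inv_cancel₀ hr.ne',
      ENNReal.ofReal_one, one_pow, one_mul]
  rw [h3] at h2
  rw [h1]
  refine (enorm_integral_le_lintegral_enorm _).trans (le_trans (le_of_eq ?_) h2)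
  simp_rw [enorm_mul]
  rfl

/-! ### Blocks as distributions given by functions -/

lemma DyadicGenerator.aestronglyMeasurable_kernel_mul (φ : DyadicGenerator d) (j : ℤ)
    {f : E d → ℂ} (hf : AEStronglyMeasurable f volume) :
    AEStronglyMeasurable (fun z : E d × E d => φ.kernel j (z.2 - z.1) * f z.2)
      (volume.prod volume) :=
  ((φ.kernel j).continuous.comp (by fun_prop)).aestronglyMeasurable.mul hf.comp_snd

lemma DyadicGenerator.aestronglyMeasurable_blockFun (φ : DyadicGenerator d) (j : ℤ)
    {f : E d → ℂ} (hf : AEStronglyMeasurable f volume) :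
    AEStronglyMeasurable (φ.blockFun j f) volume :=
  (φ.aestronglyMeasurable_kernel_mul j hf).integral_prod_right'

/-- Fubini. The double integral converges absolutely because Hölder bounds the inner one uniformly
in `x` and `ψ` is integrable. -/
lemma DyadicGenerator.block_apply (φ : DyadicGenerator d) {p q : ℝ}
    (hpq : p.HolderConjugate q) {f : E d → ℂ} (hf : MemLp f (ENNReal.ofReal p) volume)
    {u : DotDistribution d} (hu : Represents f u) (j : ℤ) (ψ : 𝓢(E d, ℂ)) :
    φ.block j u ψ = ∫ x, ψ x * φ.blockFun j f x := by
  have h1 : φ.block j u ψ = ∫ y, φ.transpose j ψ y * f y :=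
    (hu ⟨φ.transpose j ψ, φ.transpose_mem j ψ⟩).2
  have hint : Integrable (fun z : E d × E d => ψ z.1 * (φ.kernel j (z.2 - z.1) * f z.2))
      (volume.prod volume) := by
    have hm := (ψ.continuous.comp continuous_fst).aestronglyMeasurable.mul
      (φ.aestronglyMeasurable_kernel_mul j hf.1)
    refine ⟨hm, ?_⟩
    set M := ENNReal.ofReal (((2 : ℝ) ^ j) ^ (d / p)) *
      (eLpNorm (φ.kernel 0) (ENNReal.ofReal q) volume * eLpNorm f (ENNReal.ofReal p) volume)
    have hM : M < ⊤ := ENNReal.mul_lt_top ENNReal.ofReal_lt_top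
      (ENNReal.mul_lt_top (φ.eLpNorm_kernel_lt_top 0 _) hf.2)
    calc ∫⁻ z : E d × E d, ‖ψ z.1 * (φ.kernel j (z.2 - z.1) * f z.2)‖ₑ ∂(volume.prod volume)
        = ∫⁻ x, ∫⁻ y, ‖ψ x * (φ.kernel j (y - x) * f y)‖ₑ := lintegral_prod _ hm.enorm
      _ ≤ ∫⁻ x, ‖ψ x‖ₑ * M := by
        refine lintegral_mono fun x => ?_
        simp_rw [enorm_mul (ψ x)]
        rw [lintegral_const_mul' _ _ enorm_ne_top]
        gcongr
        exact φ.lintegral_kernel_mul_le hpq hf.1 j x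
      _ = (∫⁻ x, ‖ψ x‖ₑ) * M := lintegral_mul_const' _ _ hM.ne
      _ < ⊤ := ENNReal.mul_lt_top ψ.integrable.2 hM
  calc φ.block j u ψ = ∫ y, ∫ x, ψ x * (φ.kernel j (y - x) * f y) := by
        rw [h1]
        refine integral_congr_ae (Filter.Eventually.of_forall fun y => ?_)
        simp only [φ.transpose_apply, ← mul_assoc]
        rw [integral_mul_const]
    _ = ∫ x, ∫ y, ψ x * (φ.kernel j (y - x) * f y) := (integral_integral_swap hint).symm
    _ = _ := by
        refine integral_congr_ae (Filter.Eventually.of_forall fun x => ?_)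
        exact integral_const_mul _ _

lemma linftyNorm_le {T : 𝓢(E d, ℂ) →L[ℂ] ℂ} {g : E d → ℂ} (hg : AEStronglyMeasurable g volume)
    (hT : ∀ ψ : 𝓢(E d, ℂ), T ψ = ∫ x, ψ x * g x) {M : ℝ≥0∞} (hM : M ≠ ⊤)
    (hgM : ∀ x, ‖g x‖ₑ ≤ M) : linftyNorm T ≤ M := by
  have h : eLpNorm g ⊤ volume ≤ M := by
    rw [eLpNorm_exponent_top]
    exact eLpNormEssSup_le_of_ae_enorm_bound (Filter.Eventually.of_forall hgM)
  exact iInf_le_of_le g (iInf_le_of_le ⟨hg, h.trans_lt hM.lt_top⟩ (iInf_le_of_le hT h))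

lemma exists_represents {p q : ℝ} (hpq : p.HolderConjugate q) {f : E d → ℂ}
    (hf : MemLp f (ENNReal.ofReal p) volume) : ∃ u : DotDistribution d, Represents f u := by
  have hp : Fact (1 ≤ ENNReal.ofReal p) := ⟨by simpa using hpq.lt.le⟩
  have hT : Continuous (Lp.toTemperedDistribution (μ := volume) (hf.toLp f)) :=
    ContinuousLinearMap.cont _
  let T : 𝓢(E d, ℂ) →L[ℂ] ℂ :=
    ⟨(Lp.toTemperedDistribution (μ := volume) (hf.toLp f)).toLinearMap, hT⟩
  refine ⟨T ∘L (dotSchwartz d).subtypeL, fun ψ => ⟨?_, ?_⟩⟩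
  · rw [← memLp_one_iff_integrable]
    exact hf.mul ((ψ : 𝓢(E d, ℂ)).memLp (ENNReal.ofReal q)) (hpqr := hpq.symm.ennrealOfReal)
  · change Lp.toTemperedDistribution (μ := volume) (hf.toLp f) (ψ : 𝓢(E d, ℂ)) = _
    rw [Lp.toTemperedDistribution_apply]
    refine integral_congr_ae ?_
    filter_upwards [hf.coeFn_toLp] with x hx
    rw [hx, smul_eq_mul]

/-! ### Summation over frequencies -/

lemma tsum_ofReal_pow_natAbs_ne_top {ρ : ℝ} (h0 : 0 ≤ ρ) (h1 : ρ < 1) :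
    ∑' j : ℤ, ENNReal.ofReal (ρ ^ j.natAbs) ≠ ⊤ := by
  have h := summable_geometric_of_lt_one h0 h1
  have h2 : Summable fun j : ℤ => ρ ^ j.natAbs :=
    Summable.of_nat_of_neg (by simpa using h) (by simpa using h)
  rw [← ENNReal.ofReal_tsum_of_nonneg (fun _ => by positivity) h2]
  exact ENNReal.ofReal_ne_top

lemma DyadicGenerator.exists_besovNorm_neg_one_le (φ : DyadicGenerator d) {p : ℝ} (hp : 1 < p)
    (hpd : p < d) : ∃ C : ℝ≥0, ∀ f : E d → ℂ, Membmo f → MemLp f (ENNReal.ofReal p) volume →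
      ∀ u : DotDistribution d, Represents f u →
        besovNorm φ (-1) u ≤ C * (bmoNorm f + eLpNorm f (ENNReal.ofReal p) volume) := by
  have hpq := Real.HolderConjugate.conjExponent hp
  set q := p.conjExponent
  obtain ⟨A, hA⟩ := φ.exists_enorm_blockFun_le_BMOSeminorm hpq
  set K := eLpNorm (φ.kernel 0) (ENNReal.ofReal q) volume
  have hK : K ≠ ⊤ := (φ.eLpNorm_kernel_lt_top 0 _).ne
  have hs : 0 < (d : ℝ) / p - 1 := by
    rw [sub_pos, one_lt_div (by linarith)]
    exact hpd
  -- The smaller of the two decay rates: `1` for `j ≥ 0`, from the Besov weight, and `d/p - 1` for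
  -- `j < 0`. Both halves are then dominated by `ρ ^ |j|`.
  set δ := min 1 ((d : ℝ) / p - 1)
  have hδ : 0 < δ := lt_min one_pos hs
  set ρ : ℝ := 2 ^ (-δ) with hρ
  have hρ0 : 0 < ρ := by positivity
  have hρ1 : ρ < 1 := Real.rpow_lt_one_of_one_lt_of_neg one_lt_two (neg_lt_zero.2 hδ)
  set W := ∑' j : ℤ, ENNReal.ofReal (ρ ^ j.natAbs)
  have hW : W ≠ ⊤ := tsum_ofReal_pow_natAbs_ne_top hρ0.le hρ1
  set M : ℝ≥0∞ := 2 * A * oscConst d + K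
  have hM : M ≠ ⊤ := ENNReal.add_ne_top.2 ⟨ENNReal.mul_ne_top
    (ENNReal.mul_ne_top (by simp) (by simp)) (oscConst_ne_top d), hK⟩
  refine ⟨(W * M).toNNReal, fun f hf hfp u hu => ?_⟩
  rw [ENNReal.coe_toNNReal (ENNReal.mul_ne_top hW hM), mul_assoc, ← ENNReal.tsum_mul_right]
  set N := bmoNorm f + eLpNorm f (ENNReal.ofReal p) volume
  have hρj : ∀ j : ℤ, ρ ^ j.natAbs = (2 : ℝ) ^ (-δ * |(j : ℝ)|) := fun j => by
    rw [hρ, ← Real.rpow_natCast, ← Real.rpow_mul (by norm_num), Nat.cast_natAbs, Int.cast_abs]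
  refine ENNReal.tsum_le_tsum fun j => ?_
  rcases le_or_gt 0 j with hj | hj
  -- High frequencies: the bound by the oscillation, uniform in `j`.
  · have h1 : linftyNorm (φ.block j u) ≤ M * N := by
      have hB : A * (oscConst d * BMOSeminorm f) ≤ 2 * A * oscConst d * bmoNorm f := by
        calc A * (oscConst d * BMOSeminorm f) ≤ A * (oscConst d * (2 * bmoNorm f)) := by
              gcongr
              exact BMOSeminorm_le_two_mul_bmoNorm f
          _ = _ := by ring
      refine (linftyNorm_le (φ.aestronglyMeasurable_blockFun j hfp.1)
        (φ.block_apply hpq hfp hu j) ?_ fun x => (hA f hf.1 hfp j x).trans hB).trans ?_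
      · exact ENNReal.mul_ne_top (ENNReal.mul_ne_top
          (ENNReal.mul_ne_top (by simp) (by simp)) (oscConst_ne_top d)) hf.2.ne
      · exact mul_le_mul' le_self_add le_self_add
    refine mul_le_mul' (ENNReal.ofReal_le_ofReal ?_) h1
    rw [hρj]
    have hj' : (0 : ℝ) ≤ j := by exact_mod_cast hj
    refine Real.rpow_le_rpow_of_exponent_le one_le_two ?_
    rw [abs_of_nonneg hj']
    nlinarith [min_le_left 1 ((d : ℝ) / p - 1)]
  -- Low frequencies: the Hölder bound, whose factor `2^{jd/p}` outweighs the weight `2^{-j}`.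
  · have h1 : linftyNorm (φ.block j u) ≤ ENNReal.ofReal (((2 : ℝ) ^ j) ^ (d / p)) *
        (K * eLpNorm f (ENNReal.ofReal p) volume) :=
      linftyNorm_le (φ.aestronglyMeasurable_blockFun j hfp.1) (φ.block_apply hpq hfp hu j)
        (ENNReal.mul_ne_top ENNReal.ofReal_ne_top (ENNReal.mul_ne_top hK hfp.2.ne))
        (φ.enorm_blockFun_le hpq hfp.1 j)
    refine (mul_le_mul_right h1 _).trans ?_
    rw [← mul_assoc, ← ENNReal.ofReal_mul (by positivity)]
    refine mul_le_mul' (ENNReal.ofReal_le_ofReal ?_) (mul_le_mul' le_add_self le_add_self)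
    rw [hρj, ← Real.rpow_intCast, ← Real.rpow_mul (by norm_num), ← Real.rpow_add (by norm_num)]
    have hj' : (j : ℝ) < 0 := by exact_mod_cast hj
    refine Real.rpow_le_rpow_of_exponent_le one_le_two ?_
    rw [abs_of_neg hj']
    nlinarith [min_le_right 1 ((d : ℝ) / p - 1)]

/-! ### Injectivity and the theorem -/

lemma ae_eq_of_sub_ae_eq_const (hd : 0 < d) {p : ℝ} (hp : 0 < p) {f g : E d → ℂ}
    (hf : MemLp f (ENNReal.ofReal p) volume) (hg : MemLp g (ENNReal.ofReal p) volume) {c : ℂ}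
    (hc : ∀ᵐ x, f x - g x = c) : f =ᵐ[volume] g := by
  -- Positive dimension makes the space noncompact, so its translation-invariant measure is
  -- infinite.
  have : Nonempty (Fin d) := ⟨⟨0, hd⟩⟩
  have h1 : MemLp (fun _ : E d => c) (ENNReal.ofReal p) volume :=
    (memLp_congr_ae hc).1 (hf.sub hg)
  rw [memLp_const_iff (by simpa using hp) ENNReal.ofReal_ne_top,
    measure_univ_of_isAddLeftInvariant] at h1
  obtain rfl : c = 0 := by simpa using h1
  filter_upwards [hc] with x hx
  exact sub_eq_zero.1 hx

end BMOEmbedding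

theorem proposition3p6 (d : ℕ) (p₀ : ℝ) (hp₀ : 1 < p₀) (hp₀d : p₀ < d)
    (φ : BMOEmbedding.DyadicGenerator d) :
    -- `bmo ∩ L^{p₀}` is contained in `BMO ∩ Ḃ^{-1}_{∞,1}`, with a norm estimate
    (∃ C : ℝ≥0, ∀ f : BMOEmbedding.E d → ℂ,
      BMOEmbedding.Membmo f → MemLp f (ENNReal.ofReal p₀) volume →
      BMOEmbedding.MemBMO f ∧
      ∃ u : BMOEmbedding.DotDistribution d,
        BMOEmbedding.Represents f u ∧ BMOEmbedding.MemBesov φ (-1) u ∧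
        BMOEmbedding.BMOSeminorm f + BMOEmbedding.besovNorm φ (-1) u ≤
          C * (BMOEmbedding.bmoNorm f + eLpNorm f (ENNReal.ofReal p₀) volume)) ∧
    -- the natural map is injective, although `BMO` consists of functions modulo constants
    (∀ f g : BMOEmbedding.E d → ℂ,
      BMOEmbedding.Membmo f → MemLp f (ENNReal.ofReal p₀) volume →
      BMOEmbedding.Membmo g → MemLp g (ENNReal.ofReal p₀) volume →
      (∃ c : ℂ, ∀ᵐ x, f x - g x = c) → f =ᵐ[volume] g) := by
  constructor
  · obtain ⟨C, hC⟩ := φ.exists_besovNorm_neg_one_le hp₀ hp₀d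
    refine ⟨2 + C, fun f hf hfp => ?_⟩
    have hB := BMOEmbedding.BMOSeminorm_le_two_mul_bmoNorm f
    obtain ⟨u, hu⟩ := BMOEmbedding.exists_represents (Real.HolderConjugate.conjExponent hp₀) hfp
    have hCu := hC f hf hfp u hu
    refine ⟨⟨hf.1, hB.trans_lt (ENNReal.mul_lt_top (by simp) hf.2)⟩, u, hu, hCu.trans_lt
      (ENNReal.mul_lt_top ENNReal.coe_lt_top (ENNReal.add_lt_top.2 ⟨hf.2, hfp.2⟩)), ?_⟩
    rw [ENNReal.coe_add, add_mul]
    refine add_le_add (hB.trans ?_) hCu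
    exact mul_le_mul' le_rfl le_self_add
  · rintro f g - hf - hg ⟨c, hc⟩
    have hd : 0 < d := by
      have : (0 : ℝ) < d := by linarith
      exact_mod_cast this
    exact BMOEmbedding.ae_eq_of_sub_ae_eq_const hd (by linarith) hf hg hc
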